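/- For an abelian topological group $(G,\tau)$ let $\widehat{(G,\tau)}$ be the group of continuous homomorphisms (characters) from $(G,\tau)$ to the unit circle $\mathbb{S}\subset\mathbb{C}$, and let $\mathbb{S}_+=\{z\in\mathbb{S}:\operatorname{Re} z\ge 0\}$. A set $A\subseteq G$ is quasi-convex if for every $g\in G\setminus A$ there is $\chi\in\widehat{(G,\tau)}$ with $\chi(A)\subseteq\mathbb{S}_+$ and $\chi(g)\notin\mathbb{S}_+$; $(G,\tau)$ is locally quasi-convex (lqc) if it has a neighborhood base at $0$ consisting of quasi-convex sets. Two group topologies $\mu,\nu$ on $G$ are compatible if $\widehat{(G,\mu)}=\widehat{(G,\nu)}$. A group topology $\mu$ on $G$ is a Mackey group topology if it is lqc and finer than or equal to every lqc group topology on $G$ compatible with $\mu$. An lqc group $(G,\tau)$ is pre-Mackey if there is a Mackey group topology on $G$ compatible with $\tau$ (one then says that $(G,\tau)$ has a Mackey group topology); it is quasi-Mackey if there is no lqc group topology on $G$ compatible with $\tau$ and strictly finer than $\tau$. A space is zero-dimensional if it is a nonempty $T_1$-space with a base of closed-and-open sets. For a Tychonoff space $X$, $A(X)$ denotes the free abelian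 topological group over $X$, i.e. the free abelian group on $X$ with the finest group topology for which the canonical map from $X$ is continuous; equivalently, $X$ is a subspace of $A(X)$ and every continuous map from $X$ to an abelian topological group extends uniquely to a continuous homomorphism on $A(X)$. Theorem. Let $X$ be a non-discrete metrizable space. If $X$ is zero-dimensional, then the (locally quasi-convex) group $A(X)$ is neither a pre-Mackey group nor a quasi-Mackey group. In particular, if $X$ is countable, then $A(X)$ has no Mackey group topology. -/

import Mathlib

open Topology TopologicalSpace

/-- A zero-dimensional space: a nonempty T₁-space with a base of closed-and-open sets. -/
structure IsZeroDimensional (X : Type*) [TopologicalSpace X] : Prop where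
  nonempty : Nonempty X
  t1 : T1Space X
  clopen_base : IsTopologicalBasis {s : Set X | IsClopen s}

section GroupTopologies

variable {G : Type*} [AddCommGroup G]

/-- A homomorphism `χ` from `G` to the unit circle is a (continuous) character of `(G, τ)`, i.e. an
element of the dual group of `(G, τ)`. -/
def IsCharacter (τ : AddGroupTopology G) (χ : AddChar G Circle) : Prop :=
  Continuous[τ.toTopologicalSpace, inferInstance] χ

/-- `A` is quasi-convex in `(G, τ)`: every point outside `A` is separated from `A` by a continuous
character and the closed right half `{z | 0 ≤ Re z}` of the circle. -/
def IsQuasiConvex (τ : AddGroupTopology G) (A : Set G) : Prop :=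
  ∀ g, g ∉ A → ∃ χ : AddChar G Circle, IsCharacter τ χ ∧
    (∀ x ∈ A, 0 ≤ (χ x : ℂ).re) ∧ ¬ 0 ≤ (χ g : ℂ).re

/-- `(G, τ)` is locally quasi-convex: the quasi-convex neighborhoods of `0` form a neighborhood
base at `0`. -/
def IsLocallyQuasiConvex (τ : AddGroupTopology G) : Prop :=
  ∀ U ∈ @nhds G τ.toTopologicalSpace 0,
    ∃ A ∈ @nhds G τ.toTopologicalSpace 0, IsQuasiConvex τ A ∧ A ⊆ U

/-- Two group topologies are compatible if they have the same continuous characters. -/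
def AreCompatible (μ ν : AddGroupTopology G) : Prop :=
  ∀ χ : AddChar G Circle, IsCharacter μ χ ↔ IsCharacter ν χ

/-- `(G, μ)` is a Mackey group: `μ` is locally quasi-convex and finer than every compatible
locally quasi-convex group topology. In Mathlib's order `μ ≤ ν` means that `μ` is finer
than `ν`. -/
def IsMackeyTopology (μ : AddGroupTopology G) : Prop :=
  IsLocallyQuasiConvex μ ∧
    ∀ ν : AddGroupTopology G, IsLocallyQuasiConvex ν → AreCompatible μ ν → μ ≤ ν

/-- For a locally quasi-convex `(G, τ)`: it is a pre-Mackey group if some Mackey group topology on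
`G` is compatible with `τ`. -/
def IsPreMackeyGroup (τ : AddGroupTopology G) : Prop :=
  ∃ μ : AddGroupTopology G, IsMackeyTopology μ ∧ AreCompatible μ τ

/-- For a locally quasi-convex `(G, τ)`: the group topology `μ` on `G` is quasi-Mackey if it is
locally quasi-convex, compatible with `τ`, and no locally quasi-convex group topology
compatible with `τ` is strictly finer than `μ`. -/
def IsQuasiMackeyTopology (τ μ : AddGroupTopology G) : Prop :=
  IsLocallyQuasiConvex μ ∧ AreCompatible μ τ ∧
    ¬ ∃ ν : AddGroupTopology G, IsLocallyQuasiConvex ν ∧ AreCompatible ν τ ∧ ν < μ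

/-- `(G, τ)` is a quasi-Mackey group if `τ` is a quasi-Mackey group topology for `τ`. -/
def IsQuasiMackeyGroup (τ : AddGroupTopology G) : Prop :=
  IsQuasiMackeyTopology τ τ

end GroupTopologies

section FreeAbelianTopologicalGroup

variable (X : Type*) [TopologicalSpace X]

/-- The topology of the free abelian topological group `A(X)`: the finest group topology on the
free abelian group on `X` for which the canonical map from `X` is continuous. The lemmas below
show that it has the defining properties of `A(X)`. -/
noncomputable def freeAbelianTopology : AddGroupTopology (FreeAbelianGroup X) :=
  AddGroupTopology.coinduced FreeAbelianGroup.of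

variable {X}

theorem continuous_of_freeAbelianTopology :
    Continuous[inferInstance, (freeAbelianTopology X).toTopologicalSpace]
      (FreeAbelianGroup.of : X → FreeAbelianGroup X) :=
  AddGroupTopology.coinduced_continuous _

/-- The extension of a continuous map from `X` to an abelian topological group is continuous on
`A(X)`. -/
theorem continuous_lift_freeAbelianTopology {H : Type*} [AddCommGroup H] [TopologicalSpace H]
    [IsTopologicalAddGroup H] (f : X → H) (hf : Continuous f) :
    Continuous[(freeAbelianTopology X).toTopologicalSpace, inferInstance]
      (FreeAbelianGroup.lift f) := by
  let t : TopologicalSpace (FreeAbelianGroup X) :=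
    TopologicalSpace.induced (FreeAbelianGroup.lift f) inferInstance
  have ht : @IsTopologicalAddGroup _ t _ := topologicalAddGroup_induced (FreeAbelianGroup.lift f)
  let b : AddGroupTopology (FreeAbelianGroup X) :=
    { toTopologicalSpace := t, toIsTopologicalAddGroup := ht }
  have hb : freeAbelianTopology X ≤ b := by
    refine sInf_le ?_
    change TopologicalSpace.coinduced FreeAbelianGroup.of _ ≤ t
    rw [← continuous_iff_coinduced_le, continuous_induced_rng]
    convert hf using 1
    funext x
    simp
  rw [continuous_iff_le_induced]
  exact hb

/-- Every continuous map from `X` to an abelian topological group extends uniquely to a continuous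
homomorphism on `A(X)`. -/
theorem existsUnique_extension_freeAbelianTopology {H : Type*} [AddCommGroup H]
    [TopologicalSpace H] [IsTopologicalAddGroup H] (f : X → H) (hf : Continuous f) :
    ∃! F : FreeAbelianGroup X →+ H,
      Continuous[(freeAbelianTopology X).toTopologicalSpace, inferInstance] F ∧
        ∀ x, F (FreeAbelianGroup.of x) = f x := by
  refine ⟨FreeAbelianGroup.lift f, ⟨continuous_lift_freeAbelianTopology f hf, by simp⟩, ?_⟩
  rintro F ⟨-, hF⟩
  exact FreeAbelianGroup.lift_ext _ _ (by simp [hF])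

/-- A Tychonoff space `X` is a subspace of `A(X)`. -/
theorem isEmbedding_of_freeAbelianTopology [CompletelyRegularSpace X] :
    @IsEmbedding _ _ _ (freeAbelianTopology X).toTopologicalSpace
      (FreeAbelianGroup.of : X → FreeAbelianGroup X) := by
  let _ := (freeAbelianTopology X).toTopologicalSpace
  refine ⟨isInducing_iff_nhds.2 fun x => le_antisymm
    (continuous_of_freeAbelianTopology.continuousAt.tendsto.le_comap) ?_,
    FreeAbelianGroup.of_injective⟩
  intro U hU
  obtain ⟨V, hVU, hV, hxV⟩ := mem_nhds_iff.1 hU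
  obtain ⟨f, hf, hfx, hfV⟩ :=
    CompletelyRegularSpace.completely_regular x Vᶜ hV.isClosed_compl (by simpa using hxV)
  have hg : Continuous fun y => (f y : ℝ) := continuous_subtype_val.comp hf
  have hF := continuous_lift_freeAbelianTopology _ hg
  refine Filter.mem_comap.2
    ⟨FreeAbelianGroup.lift (fun y => (f y : ℝ)) ⁻¹' Set.Iio 1,
      (isOpen_Iio.preimage hF).mem_nhds (by simp [hfx]), fun y hy => hVU ?_⟩
  by_contra hyV
  have h1 := hfV hyV
  simp [h1] at hy

end FreeAbelianTopologicalGroup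

/-! Fix a non-isolated point `x₀` and a decreasing clopen base `U n` at it. For `z` of infinite
order in the circle, refine A(X) by uniform convergence on the characters `z ^ layerSum U n g`. The
result, `layerTopology U z`, is locally quasi-convex because both ingredients are, and it has no new
characters (`areCompatible_layerTopology`): otherwise some `χ (y - x₀)` accumulates at `w ≠ 1` as `y
→ x₀`, and adding up multiples `m (y - x₀)` from different layers, with `z ^ m` near 1 and `w ^ m ≠
1`, gives elements near 0 whose `χ`-value is not near 1.

The refinements for `z` and `-z` clash. Near 0 in both, every layer sum is even, since `(-z) ^ k / z
^ k = (-1) ^ k`; hence `signChar` equals 1 there and is continuous (`isCharacter_signChar_of_le`),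
although it is discontinuous on A(X). A compatible Mackey topology would refine both, and a
quasi-Mackey A(X) would equal both.

Local quasi-convexity of A(X) rests on invariant pseudonorms and on duality for the assignment
problem (`exists_perm_lipschitz`). -/

open Filter

/-! ### The right half circle and small subgroups -/

namespace Circle

theorem normSq_coe_eq_one (u : Circle) : (u : ℂ).re ^ 2 + (u : ℂ).im ^ 2 = 1 := by
  have h := u.normSq_coe
  rw [Complex.normSq_apply] at h
  linarith

theorem one_sub_re_sq (u : Circle) :
    1 - ((u ^ 2 : Circle) : ℂ).re = 2 * (1 - (u : ℂ).re) * (1 + (u : ℂ).re) := by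
  have h := u.normSq_coe_eq_one
  rw [Circle.coe_pow, sq (u : ℂ), Complex.mul_re]
  linarith

theorem norm_sub_one_sq (u : Circle) : ‖(u : ℂ) - 1‖ ^ 2 = 2 * (1 - (u : ℂ).re) := by
  have h := u.normSq_coe_eq_one
  rw [← Complex.normSq_eq_norm_sq, Complex.normSq_apply]
  simp
  linarith

theorem abs_re_le_one (u : Circle) : |(u : ℂ).re| ≤ 1 := by
  exact (Complex.abs_re_le_norm (u : ℂ)).trans_eq u.norm_coe

/-- On the right half circle squaring at least doubles `1 - re`, a quantity that never exceeds 2. -/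
theorem one_sub_re_mul_two_pow_le {u : Circle} {K : ℕ}
    (h : ∀ j ≤ K, 0 ≤ ((u ^ 2 ^ j : Circle) : ℂ).re) :
    (1 - (u : ℂ).re) * 2 ^ K ≤ 2 := by
  suffices ∀ j ≤ K, (1 - (u : ℂ).re) * 2 ^ j ≤ 1 - ((u ^ 2 ^ j : Circle) : ℂ).re by
    have h1 := this K le_rfl
    have h2 := h K le_rfl
    linarith
  intro j
  induction j with
  | zero => simp
  | succ j ih =>
    intro hj
    have h1 := ih (by omega)
    have h2 := one_sub_re_sq (u ^ 2 ^ j)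
    rw [← pow_mul, ← pow_succ] at h2
    have h3 := h j (by omega)
    have h4 := abs_le.1 (abs_re_le_one (u ^ 2 ^ j))
    rw [h2, pow_succ]
    nlinarith

/-- The circle has no small subgroups, in a uniform form for the right half circle. -/
theorem exists_forall_re_pow_nonneg_imp_mem {V : Set Circle} (hV : V ∈ 𝓝 (1 : Circle)) :
    ∃ K : ℕ, ∀ u : Circle, (∀ j ≤ K, 0 ≤ ((u ^ 2 ^ j : Circle) : ℂ).re) → u ∈ V := by
  obtain ⟨ε, hε, hV⟩ := Metric.mem_nhds_iff.1 hV
  -- The bound is `‖u - 1‖ ^ 2 = 2 (1 - re u) ≤ 4 / 2 ^ K < ε ^ 2`.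
  obtain ⟨K, hK⟩ := pow_unbounded_of_one_lt (4 / ε ^ 2) one_lt_two
  refine ⟨K, fun u hu => hV ?_⟩
  have hd : dist u 1 = dist (u : ℂ) ((1 : Circle) : ℂ) := rfl
  rw [Metric.mem_ball, hd, Circle.coe_one, dist_eq_norm]
  have h1 := one_sub_re_mul_two_pow_le hu
  have h2 := norm_sub_one_sq u
  rw [div_lt_iff₀ (by positivity)] at hK
  have h3 : (0 : ℝ) < 2 ^ K := by positivity
  refine lt_of_pow_lt_pow_left₀ 2 hε.le ?_
  rw [h2]
  by_contra! h4
  nlinarith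

theorem exists_re_pow_neg {u : Circle} (hu : u ≠ 1) : ∃ n : ℕ, ((u ^ n : Circle) : ℂ).re < 0 := by
  by_contra! h
  obtain ⟨K, hK⟩ := exists_forall_re_pow_nonneg_imp_mem (isOpen_ne.mem_nhds hu.symm)
  exact hK u (fun j _ => h _) rfl

theorem setOf_re_pos_mem_nhds : {u : Circle | 0 < (u : ℂ).re} ∈ 𝓝 (1 : Circle) :=
  (isOpen_lt continuous_const (Complex.continuous_re.comp continuous_subtype_val)).mem_nhds
    (show (0 : ℝ) < ((1 : Circle) : ℂ).re by simp)

end Circle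

/-! ### Locally quasi-convex topologies and uniform convergence on characters -/

section GroupTopologies

variable {G : Type*} [AddCommGroup G]

theorem continuous_addMonoidHom_of_tendsto_nhds_zero (τ : AddGroupTopology G) {H : Type*} [AddCommGroup H]
    [TopologicalSpace H] [IsTopologicalAddGroup H] (f : G →+ H)
    (h : Tendsto f (@nhds G τ.toTopologicalSpace 0) (𝓝 0)) :
    Continuous[τ.toTopologicalSpace, inferInstance] f := by
  let _ := τ.toTopologicalSpace
  have := τ.toIsTopologicalAddGroup
  refine continuous_of_continuousAt_zero f ?_
  simpa [ContinuousAt] using h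

theorem addGroupTopology_le_iff {τ σ : AddGroupTopology G} :
    τ ≤ σ ↔ @nhds G τ.toTopologicalSpace 0 ≤ @nhds G σ.toTopologicalSpace 0 := by
  refine ⟨fun h => nhds_mono h, fun h => ?_⟩
  let _ := σ.toTopologicalSpace
  have := σ.toIsTopologicalAddGroup
  exact continuous_id_iff_le.1 (continuous_addMonoidHom_of_tendsto_nhds_zero τ (AddMonoidHom.id G) h)

theorem isCharacter_iff {τ : AddGroupTopology G} {χ : AddChar G Circle} :
    IsCharacter τ χ ↔ ∀ V ∈ 𝓝 (1 : Circle), ∀ᶠ g in @nhds G τ.toTopologicalSpace 0, χ g ∈ V := by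
  constructor
  · intro h V hV
    have h0 := @Continuous.tendsto _ _ τ.toTopologicalSpace _ _ h 0
    rw [AddChar.map_zero_eq_one] at h0
    exact h0 hV
  · intro h
    exact continuous_addMonoidHom_of_tendsto_nhds_zero τ χ.toAddMonoidHom h

theorem IsCharacter.mono {τ σ : AddGroupTopology G} (h : τ ≤ σ) {χ : AddChar G Circle}
    (hχ : IsCharacter σ χ) : IsCharacter τ χ :=
  continuous_le_dom h hχ

theorem IsCharacter.pow {τ : AddGroupTopology G} {χ : AddChar G Circle}
    (hχ : IsCharacter τ χ) (n : ℕ) : IsCharacter τ (χ ^ n) := by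
  let _ := τ.toTopologicalSpace
  have h : Continuous fun g => (χ g) ^ n := Continuous.pow hχ n
  exact h

theorem IsQuasiConvex.mono {τ σ : AddGroupTopology G} (h : τ ≤ σ) {A : Set G}
    (hA : IsQuasiConvex σ A) : IsQuasiConvex τ A := fun g hg =>
  let ⟨χ, h1, h2⟩ := hA g hg
  ⟨χ, h1.mono h, h2⟩

theorem IsQuasiConvex.inter {τ : AddGroupTopology G} {A B : Set G}
    (hA : IsQuasiConvex τ A) (hB : IsQuasiConvex τ B) : IsQuasiConvex τ (A ∩ B) := by
  intro g hg
  by_cases h : g ∈ A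
  · obtain ⟨χ, h1, h2, h3⟩ := hB g fun hb => hg ⟨h, hb⟩
    exact ⟨χ, h1, fun x hx => h2 x hx.2, h3⟩
  · obtain ⟨χ, h1, h2, h3⟩ := hA g h
    exact ⟨χ, h1, fun x hx => h2 x hx.1, h3⟩

/-- Polars of families of characters are quasi-convex. -/
theorem isQuasiConvex_polar {τ : AddGroupTopology G} {ι : Type*} {χ : ι → AddChar G Circle}
    (hχ : ∀ i, IsCharacter τ (χ i)) : IsQuasiConvex τ {g | ∀ i, 0 ≤ (χ i g : ℂ).re} := by
  intro g hg
  simp only [Set.mem_ofPred_eq, not_forall] at hg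
  obtain ⟨i, hi⟩ := hg
  exact ⟨χ i, hχ i, fun x hx => hx i, hi⟩

theorem nhds_zero_inf (τ σ : AddGroupTopology G) :
    @nhds G (τ ⊓ σ).toTopologicalSpace 0 =
      @nhds G τ.toTopologicalSpace 0 ⊓ @nhds G σ.toTopologicalSpace 0 :=
  nhds_inf

theorem IsLocallyQuasiConvex.inf {τ σ : AddGroupTopology G} (hτ : IsLocallyQuasiConvex τ)
    (hσ : IsLocallyQuasiConvex σ) : IsLocallyQuasiConvex (τ ⊓ σ) := by
  intro U hU
  rw [nhds_zero_inf, mem_inf_iff_superset] at hU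
  obtain ⟨V, hV, W, hW, hU⟩ := hU
  obtain ⟨A, hA, hA', hAV⟩ := hτ V hV
  obtain ⟨B, hB, hB', hBW⟩ := hσ W hW
  refine ⟨A ∩ B, ?_, (hA'.mono inf_le_left).inter (hB'.mono inf_le_right),
    (Set.inter_subset_inter hAV hBW).trans hU⟩
  rw [nhds_zero_inf]
  exact inter_mem_inf hA hB

open scoped UniformConvergence

variable {ι : Type*}

/-- The group topology of uniform convergence on a family of characters. -/
noncomputable def uniformTopology (χ : ι → AddChar G Circle) : AddGroupTopology G :=
  let F : G →+ Additive (ι →ᵤ Circle) :=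
    { toFun := fun g => Additive.ofMul (UniformFun.ofFun fun i => χ i g)
      map_zero' := by
        simp only [AddChar.map_zero_eq_one]
        rfl
      map_add' := fun a b => by
        simp only [AddChar.map_add_eq_mul]
        rfl }
  { toTopologicalSpace := TopologicalSpace.induced F inferInstance
    toIsTopologicalAddGroup := topologicalAddGroup_induced F }

theorem hasBasis_nhds_zero_uniformTopology (χ : ι → AddChar G Circle) :
    (@nhds G (uniformTopology χ).toTopologicalSpace 0).HasBasis
      (fun V : Set Circle => V ∈ 𝓝 (1 : Circle)) fun V => {g | ∀ i, χ i g ∈ V} := by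
  have h := (UniformFun.hasBasis_nhds_one (α := ι) (G := Circle)).comap
    (fun g : G => (UniformFun.ofFun fun i => χ i g : ι →ᵤ Circle))
  have h2 : @nhds G (uniformTopology χ).toTopologicalSpace 0 =
      comap (fun g : G => (UniformFun.ofFun fun i => χ i g : ι →ᵤ Circle))
        (𝓝 (1 : ι →ᵤ Circle)) := by
    rw [uniformTopology, nhds_induced, map_zero]
    rfl
  rw [h2]
  exact h

theorem isCharacter_uniformTopology (χ : ι → AddChar G Circle) (i : ι) :
    IsCharacter (uniformTopology χ) (χ i) := by
  rw [isCharacter_iff]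
  intro V hV
  filter_upwards [(hasBasis_nhds_zero_uniformTopology χ).mem_of_mem hV] with g hg using hg i

/-- The polar of the powers `χ i ^ 2 ^ j`, `j ≤ K`, fits into a given basic neighborhood for `K`
large; it is itself a neighborhood because only finitely many exponents occur. -/
theorem isLocallyQuasiConvex_uniformTopology (χ : ι → AddChar G Circle) :
    IsLocallyQuasiConvex (uniformTopology χ) := by
  intro U hU
  obtain ⟨V, hV, hVU⟩ := (hasBasis_nhds_zero_uniformTopology χ).mem_iff.1 hU
  obtain ⟨K, hK⟩ := Circle.exists_forall_re_pow_nonneg_imp_mem hV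
  have hP := isQuasiConvex_polar (τ := uniformTopology χ)
    (χ := fun p : ι × Fin (K + 1) => χ p.1 ^ 2 ^ (p.2 : ℕ))
    fun p => (isCharacter_uniformTopology χ p.1).pow _
  refine ⟨_, ?_, hP, fun g hg => hVU fun i => hK _ fun j hj => ?_⟩
  · have hO : {u : Circle | ∀ j : Fin (K + 1), 0 < ((u ^ 2 ^ (j : ℕ) : Circle) : ℂ).re} ∈
        𝓝 (1 : Circle) := by
      refine eventually_all.2 fun j => ?_
      have : Tendsto (fun u : Circle => u ^ 2 ^ (j : ℕ)) (𝓝 1) (𝓝 1) := by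
        simpa using (continuous_pow (M := Circle) (2 ^ (j : ℕ))).tendsto 1
      exact this Circle.setOf_re_pos_mem_nhds
    filter_upwards [(hasBasis_nhds_zero_uniformTopology χ).mem_of_mem hO] with g hg p
    exact (hg p.1 p.2).le
  · exact hg (i, ⟨j, Nat.lt_succ_of_le hj⟩)

end GroupTopologies

/-! ### Characters of the free abelian topological group -/

section FreeAbelian

variable {X : Type*}

/-- The character of the free abelian group extending a circle-valued function. -/
noncomputable def charLift (f : X → Circle) : AddChar (FreeAbelianGroup X) Circle :=
  AddChar.toAddMonoidHomEquiv.symm (FreeAbelianGroup.lift fun x => Additive.ofMul (f x))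

@[simp]
theorem charLift_of (f : X → Circle) (x : X) : charLift f (FreeAbelianGroup.of x) = f x := by
  simp [charLift]

theorem addChar_freeAbelianGroup_ext {χ ψ : AddChar (FreeAbelianGroup X) Circle}
    (h : ∀ x, χ (FreeAbelianGroup.of x) = ψ (FreeAbelianGroup.of x)) : χ = ψ := by
  apply AddChar.toAddMonoidHomEquiv.injective
  exact FreeAbelianGroup.lift_ext _ _ h

theorem charLift_comp_addMonoidHom {H : Type*} [AddCommGroup H] (ψ : AddChar H Circle)
    (f : X → H) (g : FreeAbelianGroup X) :
    charLift (fun x => ψ (f x)) g = ψ (FreeAbelianGroup.lift f g) := by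
  have : charLift (fun x => ψ (f x)) = ψ.compAddMonoidHom (FreeAbelianGroup.lift f) :=
    addChar_freeAbelianGroup_ext fun x => by simp
  rw [this]
  rfl

variable [TopologicalSpace X]

theorem isCharacter_freeAbelianTopology_iff {χ : AddChar (FreeAbelianGroup X) Circle} :
    IsCharacter (freeAbelianTopology X) χ ↔ Continuous fun x => χ (FreeAbelianGroup.of x) := by
  constructor
  · intro h
    exact @Continuous.comp _ _ _ _ (freeAbelianTopology X).toTopologicalSpace _ _ _ h
      continuous_of_freeAbelianTopology
  · intro h
    have h1 := continuous_lift_freeAbelianTopology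
      (fun x => Additive.ofMul (χ (FreeAbelianGroup.of x))) h
    have h2 : χ = charLift fun x => χ (FreeAbelianGroup.of x) :=
      addChar_freeAbelianGroup_ext fun x => by simp
    rw [h2]
    exact h1

theorem freeAbelianTopology_le {σ : AddGroupTopology (FreeAbelianGroup X)}
    (h : Continuous[inferInstance, σ.toTopologicalSpace] (FreeAbelianGroup.of (α := X))) :
    freeAbelianTopology X ≤ σ :=
  sInf_le (continuous_iff_coinduced_le.1 h)

theorem tendsto_of_sub_of (x : X) :
    Tendsto (fun y => FreeAbelianGroup.of y - FreeAbelianGroup.of x) (𝓝 x)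
      (@nhds _ (freeAbelianTopology X).toTopologicalSpace 0) := by
  let _ := (freeAbelianTopology X).toTopologicalSpace
  have := (freeAbelianTopology X).toIsTopologicalAddGroup
  have h := (continuous_of_freeAbelianTopology (X := X)).tendsto x
  simpa using h.sub_const (FreeAbelianGroup.of x)

theorem continuous_of_iff {σ : AddGroupTopology (FreeAbelianGroup X)} :
    Continuous[inferInstance, σ.toTopologicalSpace] (FreeAbelianGroup.of (α := X)) ↔
      ∀ x, Tendsto (fun y => FreeAbelianGroup.of y - FreeAbelianGroup.of x) (𝓝 x)
        (@nhds _ σ.toTopologicalSpace 0) := by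
  let _ := σ.toTopologicalSpace
  have := σ.toIsTopologicalAddGroup
  rw [continuous_iff_continuousAt]
  refine forall_congr' fun x => ?_
  rw [ContinuousAt, tendsto_sub_nhds_zero_iff]

/-- Equicontinuous families of characters are equicontinuous on the free group. -/
theorem freeAbelianTopology_le_uniformTopology {ι : Type*}
    {χ : ι → AddChar (FreeAbelianGroup X) Circle}
    (h : ∀ x, ∀ V ∈ 𝓝 (1 : Circle), ∀ᶠ y in 𝓝 x, ∀ i,
      χ i (FreeAbelianGroup.of y - FreeAbelianGroup.of x) ∈ V) :
    freeAbelianTopology X ≤ uniformTopology χ := by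
  refine freeAbelianTopology_le (continuous_of_iff.2 fun x => ?_)
  exact (hasBasis_nhds_zero_uniformTopology χ).tendsto_right_iff.2 fun V hV => h x V hV

end FreeAbelian

/-! ### Continuous invariant pseudonorms -/

section InvariantNorm

variable {G : Type*} [AddCommGroup G]

/-- Threefold sums are what the chain construction of a pseudometric needs: they yield the
inequality `d x₁ x₄ ≤ 2 * max`. -/
theorem exists_seq_nhds_zero [TopologicalSpace G] [IsTopologicalAddGroup G] {U : Set G}
    (hU : U ∈ 𝓝 (0 : G)) :
    ∃ V : ℕ → Set G, V 0 ⊆ U ∧ (∀ n, V n ∈ 𝓝 (0 : G)) ∧ (∀ n, ∀ x ∈ V n, -x ∈ V n) ∧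
      ∀ n, ∀ x ∈ V (n + 1), ∀ y ∈ V (n + 1), ∀ z ∈ V (n + 1), x + y + z ∈ V n := by
  have key : ∀ A : {A : Set G // A ∈ 𝓝 (0 : G)}, ∃ B : {A : Set G // A ∈ 𝓝 (0 : G)},
      (∀ x ∈ B.1, -x ∈ B.1) ∧ ∀ x ∈ B.1, ∀ y ∈ B.1, ∀ z ∈ B.1, x + y + z ∈ A.1 := by
    rintro ⟨A, hA⟩
    obtain ⟨W, hW, hWA⟩ := exists_nhds_zero_half hA
    obtain ⟨W', hW', hWW'⟩ := exists_nhds_zero_half hW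
    have h1 : W ∩ W' ∈ 𝓝 (0 : G) := inter_mem hW hW'
    have h2 : -(W ∩ W') ∈ 𝓝 (0 : G) :=
      (continuous_neg (G := G)).tendsto' 0 0 neg_zero h1
    refine ⟨⟨(W ∩ W') ∩ -(W ∩ W'), inter_mem h1 h2⟩, fun x hx => ⟨hx.2, ?_⟩, ?_⟩
    · simpa using hx.1
    · intro x hx y hy z hz
      exact hWA _ (hWW' _ hx.1.2 _ hy.1.2) _ hz.1.1
  choose f hf1 hf2 using key
  -- Starting at the first iterate makes `V 0` symmetric, which `U` need not be.
  let V : ℕ → {A : Set G // A ∈ 𝓝 (0 : G)} := fun n => f^[n + 1] ⟨U, hU⟩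
  have hV (n : ℕ) : V (n + 1) = f (V n) := Function.iterate_succ_apply' ..
  refine ⟨fun n => (V n).1, fun x hx => ?_, fun n => (V n).2, fun n => ?_, fun n => ?_⟩
  · have h0 : (0 : G) ∈ (V 0).1 := mem_of_mem_nhds (V 0).2
    simpa using hf2 ⟨U, hU⟩ x hx 0 h0 0 h0
  · cases n with
    | zero => exact hf1 _
    | succ n => simp only [hV]; exact hf1 _
  · simp only [hV]; exact hf2 _

/-- The Birkhoff–Kakutani theorem: every neighborhood of zero contains the unit ball of a
continuous invariant pseudonorm. -/
theorem exists_pseudonorm_of_mem_nhds_zero [TopologicalSpace G] [IsTopologicalAddGroup G]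
    {U : Set G} (hU : U ∈ 𝓝 (0 : G)) :
    ∃ N : AddGroupSeminorm G, Tendsto N (𝓝 0) (𝓝 0) ∧ ∀ g, N g < 1 → g ∈ U := by
  classical
  obtain ⟨V, hVU, hV, hneg, hadd⟩ := exists_seq_nhds_zero hU
  have h0 (n : ℕ) : (0 : G) ∈ V n := mem_of_mem_nhds (hV n)
  have hanti : Antitone V := antitone_nat_of_succ_le fun n x hx => by
    simpa using hadd n x hx 0 (h0 _) 0 (h0 _)
  let q : G → NNReal := fun g => if h : ∃ n, g ∉ V n then (1 / 2) ^ Nat.find h else 0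
  have hr0 : (0 : NNReal) < 1 / 2 := by simp
  have hr1 : (1 / 2 : NNReal) < 1 := NNReal.half_lt_self one_ne_zero
  have hq {g : G} {n : ℕ} : (1 / 2) ^ n ≤ q g ↔ g ∉ V n := by
    dsimp only [q]
    split_ifs with h
    · rw [(pow_right_strictAnti₀ hr0 hr1).le_iff_ge, Nat.find_le_iff]
      exact ⟨fun ⟨m, hmn, hm⟩ hn => hm (hanti hmn hn), fun h => ⟨n, le_rfl, h⟩⟩
    · push Not at h
      simp only [h, not_true, (pow_pos hr0 _).not_ge]
  have hq0 : q 0 = 0 := by simp [q, h0]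
  have hqneg (g : G) : q (-g) = q g := by
    have h (n : ℕ) : -g ∈ V n ↔ g ∈ V n :=
      ⟨fun h => by simpa using hneg n _ h, fun h => hneg n _ h⟩
    simp only [q, h]
  let d : G → G → NNReal := fun x y => q (x - y)
  have hd0 (x : G) : d x x = 0 := by simp [d, hq0]
  have hdc (x y : G) : d x y = d y x := by simp only [d]; rw [← hqneg, neg_sub]
  let I := PseudoMetricSpace.ofPreNNDist d hd0 hdc
  have hle (x y : G) : dist x y ≤ d x y := PseudoMetricSpace.dist_ofPreNNDist_le d hd0 hdc x y
  have hge (x y : G) : (d x y : ℝ) ≤ 2 * dist x y := by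
    refine PseudoMetricSpace.le_two_mul_dist_ofPreNNDist d hd0 hdc (fun x₁ x₂ x₃ x₄ => ?_) x y
    by_cases H : ∃ n, x₁ - x₄ ∉ V n
    · have h1 : d x₁ x₄ = (1 / 2) ^ Nat.find H := dif_pos H
      rw [h1, ← div_le_iff₀' zero_lt_two, ← mul_one_div (_ ^ _), ← pow_succ]
      simp only [le_max_iff, d, hq, ← not_and_or]
      rintro ⟨h₁₂, h₂₃, h₃₄⟩
      refine Nat.find_spec H ?_
      simpa using hadd _ _ h₁₂ _ h₂₃ _ h₃₄
    · have h1 : d x₁ x₄ = 0 := dif_neg H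
      rw [h1]
      exact zero_le
  have hinv (x y a : G) : dist (x + a) (y + a) = dist x y := by
    change ((⨅ l : List G, (((x + a) :: l).zipWith d (l ++ [y + a])).sum : NNReal) : ℝ) =
      ((⨅ l : List G, ((x :: l).zipWith d (l ++ [y])).sum : NNReal) : ℝ)
    congr 1
    symm
    -- The distance is an infimum over chains; translation permutes the chains, and `d` depends only
    -- on differences.
    have hs : Function.Surjective (List.map fun g : G => g + a) :=
      (Equiv.addRight a).surjective.list_map
    refine hs.iInf_congr _ fun l => ?_
    have e1 : (x + a) :: l.map (fun g => g + a) = (x :: l).map fun g => g + a := by simp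
    have e2 : l.map (fun g => g + a) ++ [y + a] = (l ++ [y]).map fun g => g + a := by simp
    rw [e1, e2, List.zipWith_map]
    simp [d]
  -- The factor 2 compensates the loss in `hge`: outside `V 0` one has `q g ≥ 1`, hence `N g ≥ 1`.
  let N : AddGroupSeminorm G :=
    { toFun := fun g => 2 * dist g 0
      map_zero' := by simp
      add_le' := fun x y => by
        have h1 := dist_triangle (x + y) (0 + y) 0
        rw [hinv x 0 y, zero_add] at h1
        linarith
      neg' := fun x => by
        have h1 := hinv (-x) 0 x
        rw [neg_add_cancel, zero_add, dist_comm 0 x] at h1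
        rw [h1] }
  refine ⟨N, ?_, fun g hg => hVU ?_⟩
  · have hN (g : G) : 0 ≤ N g := mul_nonneg zero_le_two dist_nonneg
    rw [Metric.tendsto_nhds]
    intro ε hε
    obtain ⟨n, hn⟩ := exists_pow_lt_of_lt_one (half_pos hε) (one_half_lt_one (α := ℝ))
    filter_upwards [hV n] with g hg
    rw [Real.dist_0_eq_abs, abs_of_nonneg (hN g)]
    have h1 : q g < (1 / 2) ^ n := by
      by_contra! h
      exact hq.1 h hg
    have h2 : ((q g : NNReal) : ℝ) < (1 / 2) ^ n := by exact_mod_cast NNReal.coe_lt_coe.2 h1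
    have h3 := hle g 0
    simp only [d, sub_zero] at h3
    change 2 * dist g 0 < ε
    linarith
  · by_contra h
    have h1 : (1 / 2) ^ 0 ≤ q g := hq.2 h
    have h2 : (1 : ℝ) ≤ q g := by
      rw [pow_zero] at h1
      exact_mod_cast h1
    have h3 := hge g 0
    simp only [d, sub_zero] at h3
    change 2 * dist g 0 < 1 at hg
    linarith

end InvariantNorm

/-! ### Duality for the assignment problem -/

section Assignment

variable {X ι : Type*} [PseudoMetricSpace X] [Fintype ι]

/-- The sum ignores additive constants, so `f a = 0` may be imposed, and the normalized Lipschitz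
functions form a compact set. -/
theorem exists_lipschitz_sum_sub_max [Finite X] (x y : ι → X) :
    ∃ f : X → ℝ, LipschitzWith 1 f ∧ ∀ h : X → ℝ, LipschitzWith 1 h →
      ∑ i, (h (x i) - h (y i)) ≤ ∑ i, (f (x i) - f (y i)) := by
  rcases isEmpty_or_nonempty X with hX | ⟨⟨a⟩⟩
  · exact ⟨fun _ => 0, LipschitzWith.of_dist_le_mul fun p => isEmptyElim p, fun h _ =>
      Finset.sum_le_sum fun i _ => isEmptyElim (x i)⟩
  let K : Set (X → ℝ) := {f | LipschitzWith 1 f ∧ f a = 0}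
  have hK : IsCompact K := by
    refine (isCompact_univ_pi fun b => isCompact_Icc (a := -dist b a) (b := dist b a)).of_isClosed_subset
      ?_ ?_
    · have : K = (⋂ p : X × X, {f | dist (f p.1) (f p.2) ≤ dist p.1 p.2}) ∩ {f | f a = 0} := by
        ext f
        simp [K, lipschitzWith_iff_dist_le_mul]
      rw [this]
      refine (isClosed_iInter fun p => isClosed_le ?_ continuous_const).inter
        (isClosed_eq (continuous_apply a) continuous_const)
      exact (continuous_apply p.1).dist (continuous_apply p.2)
    · rintro f ⟨hf, hfa⟩ b -
      have := hf.dist_le_mul b a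
      rw [hfa, Real.dist_0_eq_abs, NNReal.coe_one, one_mul] at this
      exact abs_le.1 this
  obtain ⟨f, hf, hmax⟩ := hK.exists_isMaxOn
    ⟨fun _ => 0, LipschitzWith.const 0 |>.weaken zero_le, rfl⟩
    (f := fun f : X → ℝ => ∑ i, (f (x i) - f (y i)))
    (by fun_prop)
  refine ⟨f, hf.1, fun h hh => ?_⟩
  have h1 : (fun b => h b - h a) ∈ K :=
    ⟨LipschitzWith.of_dist_le_mul fun b c => by simpa using hh.dist_le_mul b c, sub_self _⟩
  simpa only [Set.mem_ofPred_eq, sub_sub_sub_cancel_right] using hmax h1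

/-- Take an optimal potential `f` and apply Hall's theorem to the tight pairs. If Hall's condition
failed for `S`, raising `f` slightly on the points tightly reached from `S` would keep it
1-Lipschitz and increase the sum. -/
theorem exists_perm_lipschitz_of_finite [Finite X] (x y : ι → X) :
    ∃ (σ : Equiv.Perm ι) (f : X → ℝ), LipschitzWith 1 f ∧
      ∀ i, f (x i) - f (y (σ i)) = dist (x i) (y (σ i)) := by
  classical
  obtain ⟨f, hf, hmax⟩ := exists_lipschitz_sum_sub_max x y
  have hfd (a b : X) : f a - f b ≤ dist a b := by
    have := hf.dist_le_mul a b
    rw [NNReal.coe_one, one_mul, Real.dist_eq] at this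
    exact (le_abs_self _).trans this
  have hall : ∀ S : Finset ι, S.card ≤
      (Finset.univ.filter fun j => ∃ i ∈ S, f (x i) - f (y j) = dist (x i) (y j)).card := by
    intro S
    let A : Set X := {b | ∃ i ∈ S, f (x i) - f b = dist (x i) b}
    -- Tightness is transitive by the triangle inequality, so no tight pair leaves `A`.
    have hslack : ∀ p : X × X, p.1 ∈ A → p.2 ∉ A → f p.1 - f p.2 < dist p.1 p.2 := by
      rintro ⟨a, b⟩ ⟨i, hi, ha⟩ hb
      refine lt_of_le_of_ne (hfd _ _) fun h => hb ⟨i, hi, le_antisymm (hfd _ _) ?_⟩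
      have := dist_triangle (x i) a b
      dsimp only at h ha
      linarith
    have hev : ∀ᶠ ε : ℝ in 𝓝[>] 0, ∀ p : X × X, p.1 ∈ A → p.2 ∉ A →
        f p.1 - f p.2 + ε < dist p.1 p.2 := by
      refine eventually_all.2 fun p => ?_
      by_cases h : p.1 ∈ A ∧ p.2 ∉ A
      · have h1 : Tendsto (fun ε : ℝ => f p.1 - f p.2 + ε) (𝓝[>] 0) (𝓝 (f p.1 - f p.2)) :=
          tendsto_nhdsWithin_of_tendsto_nhds (Continuous.tendsto' (by fun_prop) _ _ (by simp))
        filter_upwards [h1.eventually_lt_const (hslack p h.1 h.2)] with ε hε _ _ using hε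
      · exact Eventually.of_forall fun ε h1 h2 => absurd ⟨h1, h2⟩ h
    obtain ⟨ε, hε, hε0⟩ := (hev.and self_mem_nhdsWithin).exists
    have hε0 : 0 < ε := hε0
    let g : X → ℝ := fun b => f b + if b ∈ A then ε else 0
    have hgd (a b : X) : g a - g b ≤ dist a b := by
      have h1 := hfd a b
      by_cases ha : a ∈ A <;> by_cases hb : b ∈ A <;> simp only [g, ha, hb, if_true, if_false]
      · linarith
      · have := hε (a, b) ha hb
        dsimp only at this
        linarith
      · linarith
      · linarith
    have hg : LipschitzWith 1 g := LipschitzWith.of_dist_le_mul fun a b => by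
      rw [NNReal.coe_one, one_mul, Real.dist_eq, abs_le]
      have h1 := hgd a b
      have h2 := hgd b a
      rw [dist_comm] at h2
      constructor <;> linarith
    have h1 := hmax g hg
    have h2 : ∑ i, (g (x i) - g (y i)) = ∑ i, (f (x i) - f (y i)) +
        (((Finset.univ.filter fun i => x i ∈ A).card : ℝ) -
          (Finset.univ.filter fun i => y i ∈ A).card) * ε := by
      have hc (z : ι → X) : ∑ i, (if z i ∈ A then ε else 0) =
          ((Finset.univ.filter fun i => z i ∈ A).card : ℝ) * ε := by
        rw [← Finset.sum_filter, Finset.sum_const, nsmul_eq_mul]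
      simp only [g, Finset.sum_sub_distrib, Finset.sum_add_distrib, hc]
      ring
    have h3 : ((Finset.univ.filter fun i => x i ∈ A).card : ℝ) ≤
        (Finset.univ.filter fun i => y i ∈ A).card := by
      by_contra! h
      have := mul_pos (sub_pos.2 h) hε0
      linarith
    refine (Finset.card_le_card fun i hi => ?_).trans (Nat.cast_le.1 h3)
    exact Finset.mem_filter.2 ⟨Finset.mem_univ _, i, hi, by simp⟩
  obtain ⟨s, hs, hs'⟩ := (Fintype.all_card_le_filter_rel_iff_exists_injective _).1 hall
  exact ⟨Equiv.ofBijective s (Finite.injective_iff_bijective.1 hs), f, hf, hs'⟩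

/-- Duality for the assignment problem: some matching and some `1`-Lipschitz potential are
complementary. -/
theorem exists_perm_lipschitz (x y : ι → X) :
    ∃ (σ : Equiv.Perm ι) (f : X → ℝ), LipschitzWith 1 f ∧
      ∀ i, f (x i) - f (y (σ i)) = dist (x i) (y (σ i)) := by
  classical
  let S : Set X := Set.range x ∪ Set.range y
  have : Finite S := ((Set.finite_range x).union (Set.finite_range y)).to_subtype
  obtain ⟨σ, f, hf, h⟩ := exists_perm_lipschitz_of_finite (X := S)
    (fun i => ⟨x i, Or.inl ⟨i, rfl⟩⟩) (fun i => ⟨y i, Or.inr ⟨i, rfl⟩⟩)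
  let f₀ : X → ℝ := fun z => if hz : z ∈ S then f ⟨z, hz⟩ else 0
  have hf₀ : LipschitzOnWith 1 f₀ S := by
    rw [lipschitzOnWith_iff_restrict]
    have h0 : S.domRestrict f₀ = f := funext fun z => dif_pos z.2
    rw [h0]
    exact hf
  obtain ⟨g, hg, hfg⟩ := hf₀.extend_real
  refine ⟨σ, g, hg, fun i => ?_⟩
  have hx : x i ∈ S := Or.inl ⟨i, rfl⟩
  have hy : y (σ i) ∈ S := Or.inr ⟨σ i, rfl⟩
  rw [← hfg hx, ← hfg hy]
  simp only [f₀, hx, hy, dif_pos]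
  exact h i

end Assignment

/-! ### Local quasi-convexity of A(X) -/

section LocallyQuasiConvex

variable {X : Type*}

theorem exists_eq_sum_of_sub_sum_of (g : FreeAbelianGroup X) :
    ∃ s t : Multiset X,
      g = (s.map FreeAbelianGroup.of).sum - (t.map FreeAbelianGroup.of).sum := by
  induction g using FreeAbelianGroup.induction_on with
  | zero => exact ⟨0, 0, by simp⟩
  | of x => exact ⟨{x}, 0, by simp⟩
  | neg x _ => exact ⟨0, {x}, by simp⟩
  | add a b ha hb =>
    obtain ⟨s, t, rfl⟩ := ha
    obtain ⟨s', t', rfl⟩ := hb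
    exact ⟨s + s', t + t', by simp; abel⟩

/-- In degree 0 the positive and negative parts have equal size and can be paired arbitrarily. -/
theorem exists_eq_sum_of_sub_of {g : FreeAbelianGroup X}
    (hg : FreeAbelianGroup.lift (fun _ => (1 : ℤ)) g = 0) :
    ∃ (n : ℕ) (x y : Fin n → X),
      g = ∑ i, (FreeAbelianGroup.of (x i) - FreeAbelianGroup.of (y i)) := by
  obtain ⟨s, t, rfl⟩ := exists_eq_sum_of_sub_sum_of g
  have hcard : t.card = s.card := by
    simp only [map_sub, map_multiset_sum, Multiset.map_map, Function.comp_def,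
      FreeAbelianGroup.lift_apply_of, Multiset.map_const', Multiset.sum_replicate,
      nsmul_eq_mul, mul_one] at hg
    omega
  obtain ⟨s, rfl⟩ := Quot.exists_rep s
  obtain ⟨t, rfl⟩ := Quot.exists_rep t
  have hlen : t.length = s.length := hcard
  refine ⟨s.length, s.get, fun i => t.get (i.cast hlen.symm), ?_⟩
  rw [Finset.sum_sub_distrib]
  congr 1
  · change (s.map FreeAbelianGroup.of).sum = _
    rw [← List.sum_ofFn]
    congr 1
    exact (List.ofFn_getElem_eq_map s _).symm
  · change (t.map FreeAbelianGroup.of).sum = _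
    rw [← List.sum_ofFn]
    congr 1
    rw [← List.ofFn_getElem_eq_map t]
    exact List.ofFn_congr hlen _

variable [TopologicalSpace X]

open Real in
/-- The free abelian topological group is locally quasi-convex. -/
theorem isLocallyQuasiConvex_freeAbelianTopology :
    IsLocallyQuasiConvex (freeAbelianTopology X) := by
  intro U hU
  obtain ⟨N, hN, hNU⟩ := @exists_pseudonorm_of_mem_nhds_zero _ _
    (freeAbelianTopology X).toTopologicalSpace (freeAbelianTopology X).toIsTopologicalAddGroup U hU
  let D : PseudoMetricSpace X :=
    { dist := fun x y => N (FreeAbelianGroup.of x - FreeAbelianGroup.of y)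
      dist_self := by simp
      dist_comm := fun x y => by rw [← map_neg_eq_map N, neg_sub]
      dist_triangle := fun x y z => by
        simpa using map_add_le_add N (FreeAbelianGroup.of x - FreeAbelianGroup.of y)
          (FreeAbelianGroup.of y - FreeAbelianGroup.of z) }
  let d : X → X → ℝ := fun x y => N (FreeAbelianGroup.of x - FreeAbelianGroup.of y)
  have hd (x : X) : Tendsto (fun y => d y x) (𝓝 x) (𝓝 0) := hN.comp (tendsto_of_sub_of x)
  let F : Set (X → ℝ) := {f | ∀ x y, f x - f y ≤ d x y}
  let E : AddChar ℝ Circle := Real.fourierChar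
  have hE (t : ℝ) : ((E t : Circle) : ℂ).re = Real.cos (2 * π * t) := by
    simp only [E, Real.fourierChar_apply]
    rw [Complex.exp_ofReal_mul_I_re]
  let χ : F → AddChar (FreeAbelianGroup X) Circle := fun f => charLift fun x => E (f.1 x)
  have hχ (f : F) (g : FreeAbelianGroup X) : χ f g = E (FreeAbelianGroup.lift f.1 g) :=
    charLift_comp_addMonoidHom E f.1 g
  have hle : freeAbelianTopology X ≤ uniformTopology χ := by
    refine freeAbelianTopology_le_uniformTopology fun x V hV => ?_
    have hE0 : Tendsto E (𝓝 0) (𝓝 1) := Real.continuous_fourierChar.tendsto' 0 1 (by simp)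
    obtain ⟨ε, hε, hεV⟩ := Metric.mem_nhds_iff.1 (hE0 hV)
    filter_upwards [(hd x).eventually_lt_const hε] with y hy f
    rw [hχ]
    refine hεV ?_
    simp only [map_sub, FreeAbelianGroup.lift_apply_of, Metric.mem_ball, Real.dist_0_eq_abs]
    have h1 : f.1 y - f.1 x ≤ d y x := f.2 y x
    have h2 : f.1 x - f.1 y ≤ d x y := f.2 x y
    have h3 : d x y = d y x := dist_comm x y
    rw [abs_lt]
    constructor <;> linarith
  refine ⟨{g | ∀ f, 0 ≤ (χ f g : ℂ).re}, ?_,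
    isQuasiConvex_polar fun f => (isCharacter_uniformTopology χ f).mono hle, fun g hg => ?_⟩
  · refine addGroupTopology_le_iff.1 hle ?_
    filter_upwards [(hasBasis_nhds_zero_uniformTopology χ).mem_of_mem Circle.setOf_re_pos_mem_nhds]
      with g hg f using (hg f).le
  have hd0 (x y : X) : 0 ≤ d x y := apply_nonneg N _
  have hbound (f : X → ℝ) (hf : f ∈ F) : FreeAbelianGroup.lift f g ≤ 1 / 4 := by
    by_contra! h
    set s := FreeAbelianGroup.lift f g with hs
    -- A character sees `s` only modulo 1. Since `F` is closed under scaling by `t ≤ 1`, a value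
    -- above `1 / 4` can be moved into `(1 / 4, 1 / 2]`, where the cosine is negative.
    have hscale (t : ℝ) (h0 : 0 ≤ t) (h1 : t ≤ 1) : 0 ≤ Real.cos (2 * π * (t * s)) := by
      have ht : (fun x => t * f x) ∈ F := fun x y => by
        have := mul_le_mul_of_nonneg_left (hf x y) h0
        have := mul_le_of_le_one_left (hd0 x y) h1
        simp only
        linarith
      have h2 := hg ⟨_, ht⟩
      have h3 : FreeAbelianGroup.lift (fun x => t * f x) g = t * s :=
        congrArg (fun φ : FreeAbelianGroup X →+ ℝ => φ g) (FreeAbelianGroup.lift_ext _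
          ((AddMonoidHom.mulLeft t).comp (FreeAbelianGroup.lift f)) fun x => by simp)
      rwa [hχ, h3, hE] at h2
    rcases le_total s (1 / 2) with h2 | h2
    · have h3 := hscale 1 zero_le_one le_rfl
      refine absurd h3 (not_le.2 (Real.cos_neg_of_pi_div_two_lt_of_lt ?_ ?_)) <;>
        nlinarith [pi_pos]
    · have h3 := hscale (1 / (2 * s)) (by positivity) (by rw [div_le_one] <;> linarith)
      have h4 : 2 * π * (1 / (2 * s) * s) = π := by field_simp
      rw [h4, Real.cos_pi] at h3
      linarith
  -- All constants lie in `F`, so every real multiple of the degree is at most `1 / 4`.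
  have hdeg : FreeAbelianGroup.lift (fun _ => (1 : ℤ)) g = 0 := by
    set m := FreeAbelianGroup.lift (fun _ : X => (1 : ℤ)) g with hm
    have hconst (c : ℝ) : c * m ≤ 1 / 4 := by
      have h1 : FreeAbelianGroup.lift (fun _ : X => c) g = c * m :=
        congrArg (fun φ : FreeAbelianGroup X →+ ℝ => φ g) (FreeAbelianGroup.lift_ext _
          (((AddMonoidHom.mulLeft c).comp (Int.castAddHom ℝ)).comp
            (FreeAbelianGroup.lift fun _ : X => (1 : ℤ))) fun x => by simp)
      rw [← h1]
      exact hbound _ fun x y => by simpa using hd0 x y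
    have h1 := hconst m
    by_contra h
    have h2 : (1 : ℝ) ≤ m * m := by
      exact_mod_cast Int.add_one_le_of_lt (mul_self_pos.2 h)
    linarith
  obtain ⟨n, x, y, rfl⟩ := exists_eq_sum_of_sub_of hdeg
  -- For the optimal matching the total distance, which dominates `N g`, equals the value of `f` on
  -- `g`, hence is at most `1 / 4`.
  obtain ⟨σ, f, hf, hσ⟩ := exists_perm_lipschitz (X := X) x y
  have hfF : f ∈ F := fun a b => by
    have := hf.dist_le_mul a b
    rw [NNReal.coe_one, one_mul, Real.dist_eq] at this
    exact (le_abs_self _).trans this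
  have hsum : ∑ i, (FreeAbelianGroup.of (x i) - FreeAbelianGroup.of (y i)) =
      ∑ i, (FreeAbelianGroup.of (x i) - FreeAbelianGroup.of (y (σ i))) := by
    simp only [Finset.sum_sub_distrib]
    rw [Equiv.sum_comp σ fun i => FreeAbelianGroup.of (y i)]
  have h1 := hbound f hfF
  rw [hsum] at h1 ⊢
  simp only [map_sum, map_sub, FreeAbelianGroup.lift_apply_of, hσ] at h1
  refine hNU _ (lt_of_le_of_lt ?_ (show (1 / 4 : ℝ) < 1 by norm_num))
  exact (Finset.le_sum_of_subadditive N (map_zero N).le (map_add_le_add N) _ _).trans h1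

end LocallyQuasiConvex

/-! ### Elements of infinite order in the circle -/

namespace Circle

theorem denseRange_zpow {z : Circle} (hz : ¬ IsOfFinOrder z) :
    DenseRange fun j : ℤ => z ^ j := by
  have : Fact (0 < (1 : ℝ)) := ⟨one_pos⟩
  have hs : Function.Surjective (AddCircle.toCircle (T := 1)) :=
    fun u => by
      obtain ⟨a, ha⟩ := (AddCircle.homeomorphCircle (one_ne_zero (α := ℝ))).surjective u
      exact ⟨a, by rw [← ha, AddCircle.homeomorphCircle_apply]⟩
  obtain ⟨a, rfl⟩ := hs z
  have ha : addOrderOf a = 0 := by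
    rw [addOrderOf_eq_zero_iff']
    intro n hn h
    refine hz (isOfFinOrder_iff_pow_eq_one.2 ⟨n, hn, ?_⟩)
    rw [← AddCircle.toCircle_nsmul, h, AddCircle.toCircle_zero]
  have h := hs.denseRange.comp (AddCircle.denseRange_zsmul_iff.2 ha) AddCircle.continuous_toCircle
  convert h using 2 with j
  exact (AddCircle.toCircle_zsmul a j).symm

theorem exists_not_isOfFinOrder : ∃ z : Circle, ¬ IsOfFinOrder z := by
  have : Fact (0 < (1 : ℝ)) := ⟨one_pos⟩
  have h : addOrderOf ((√2 : ℝ) : AddCircle (1 : ℝ)) = 0 :=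
    AddCircle.denseRange_zsmul_iff.1
      (AddCircle.denseRange_zsmul_coe_iff.2 (by simpa using irrational_sqrt_two))
  refine ⟨AddCircle.toCircle ((√2 : ℝ) : AddCircle (1 : ℝ)), fun hf => ?_⟩
  obtain ⟨n, hn, hz⟩ := isOfFinOrder_iff_pow_eq_one.1 hf
  rw [← AddCircle.toCircle_nsmul, ← AddCircle.toCircle_zero (T := 1)] at hz
  exact addOrderOf_eq_zero_iff'.1 h n hn (AddCircle.injective_toCircle one_ne_zero hz)

theorem not_isOfFinOrder_neg {z : Circle} (hz : ¬ IsOfFinOrder z) : ¬ IsOfFinOrder (-z) := by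
  intro h
  have h2 := h.pow (n := 2)
  rw [neg_sq] at h2
  exact hz (h2.of_pow two_ne_zero)

/-- Only exponents `q * j + 1` are used: with `q` a period of `w`, or `q = 2` if `w` has infinite
order, they never kill `w`, while density of the powers of `z ^ q` brings `z ^ (q * j)` close to
`z⁻¹`. -/
theorem exists_zpow_mem_zpow_ne_one {z w : Circle} (hz : ¬ IsOfFinOrder z) (hw : w ≠ 1)
    {V : Set Circle} (hV : V ∈ 𝓝 (1 : Circle)) : ∃ m : ℤ, z ^ m ∈ V ∧ w ^ m ≠ 1 := by
  obtain ⟨q, hq, hq'⟩ : ∃ q : ℕ, q ≠ 0 ∧ ∀ j : ℤ, w ^ (q * j + 1) ≠ 1 := by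
    by_cases h : IsOfFinOrder w
    · obtain ⟨q, hq, hwq⟩ := isOfFinOrder_iff_pow_eq_one.1 h
      refine ⟨q, hq.ne', fun j => ?_⟩
      rwa [zpow_add_one, zpow_mul, zpow_natCast, hwq, one_zpow, one_mul]
    · refine ⟨2, two_ne_zero, fun j hj => h (isOfFinOrder_iff_zpow_eq_one.2 ⟨_, ?_, hj⟩)⟩
      push_cast
      omega
  have hzq : ¬ IsOfFinOrder (z ^ q) := fun h => hz (h.of_pow hq)
  have hV' : (fun u => u * z) ⁻¹' V ∈ 𝓝 z⁻¹ :=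
    (continuous_mul_const z).tendsto' z⁻¹ 1 (by simp) hV
  obtain ⟨j, hj⟩ := (denseRange_zpow hzq).mem_nhds hV'
  refine ⟨q * j + 1, ?_, hq' j⟩
  rw [zpow_add_one, zpow_mul, zpow_natCast]
  exact hj

/-- The character of `ℤ` with a given value at `1`. -/
noncomputable def zpowChar (z : Circle) : AddChar ℤ Circle where
  toFun k := z ^ k
  map_zero_eq_one' := zpow_zero z
  map_add_eq_mul' := zpow_add z

end Circle

/-! ### Layers around a non-isolated point and the refined topologies -/

section Layers

variable {X : Type*}

/-- The sum of the coefficients at the points of `S`. -/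
noncomputable def coeffSum (S : Set X) : FreeAbelianGroup X →+ ℤ :=
  FreeAbelianGroup.lift (S.indicator 1)

theorem coeffSum_of_mem {S : Set X} {x : X} (hx : x ∈ S) :
    coeffSum S (FreeAbelianGroup.of x) = 1 := by
  simp [coeffSum, hx]

theorem coeffSum_of_notMem {S : Set X} {x : X} (hx : x ∉ S) :
    coeffSum S (FreeAbelianGroup.of x) = 0 := by
  simp [coeffSum, hx]

/-- For a decreasing sequence of sets, the sum of the coefficients at the points
of `U n \ U (n + 1)`. -/
noncomputable def layerSum (U : ℕ → Set X) (n : ℕ) : FreeAbelianGroup X →+ ℤ :=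
  coeffSum (U n) - coeffSum (U (n + 1))

theorem layerSum_apply (U : ℕ → Set X) (n : ℕ) (g : FreeAbelianGroup X) :
    layerSum U n g = coeffSum (U n) g - coeffSum (U (n + 1)) g := rfl

/-- The character `g ↦ z ^ layerSum U n g`. -/
noncomputable def layerChar (U : ℕ → Set X) (z : Circle) (n : ℕ) :
    AddChar (FreeAbelianGroup X) Circle :=
  (Circle.zpowChar z).compAddMonoidHom (layerSum U n)

theorem layerChar_apply (U : ℕ → Set X) (z : Circle) (n : ℕ) (g : FreeAbelianGroup X) :
    layerChar U z n g = z ^ layerSum U n g := rfl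

/-- The character sending the points of `U 0 \ {x₀}` to `-1` and the other points to `1`. -/
noncomputable def signChar (x₀ : X) (U : ℕ → Set X) : AddChar (FreeAbelianGroup X) Circle :=
  (Circle.zpowChar (-1)).compAddMonoidHom (coeffSum (U 0) - coeffSum {x₀})

theorem signChar_apply (x₀ : X) (U : ℕ → Set X) (g : FreeAbelianGroup X) :
    signChar x₀ U g = (-1) ^ (coeffSum (U 0) g - coeffSum {x₀} g) := rfl

variable [TopologicalSpace X]

/-- The topology of the free abelian topological group refined by uniform convergence on the
characters `layerChar U z n`. -/
noncomputable def layerTopology (U : ℕ → Set X) (z : Circle) :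
    AddGroupTopology (FreeAbelianGroup X) :=
  freeAbelianTopology X ⊓ uniformTopology (layerChar U z)

theorem layerTopology_le (U : ℕ → Set X) (z : Circle) :
    layerTopology U z ≤ freeAbelianTopology X := inf_le_left

theorem isLocallyQuasiConvex_layerTopology (U : ℕ → Set X) (z : Circle) :
    IsLocallyQuasiConvex (layerTopology U z) :=
  isLocallyQuasiConvex_freeAbelianTopology.inf (isLocallyQuasiConvex_uniformTopology _)

theorem nhds_zero_layerTopology (U : ℕ → Set X) (z : Circle) :
    @nhds _ (layerTopology U z).toTopologicalSpace 0 =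
      @nhds _ (freeAbelianTopology X).toTopologicalSpace 0 ⊓
        @nhds _ (uniformTopology (layerChar U z)).toTopologicalSpace 0 :=
  nhds_zero_inf _ _

variable {x₀ : X} {U : ℕ → Set X}

theorem not_isCharacter_signChar (hU : (𝓝 x₀).HasAntitoneBasis U) [(𝓝[≠] x₀).NeBot] :
    ¬ IsCharacter (freeAbelianTopology X) (signChar x₀ U) := by
  rw [isCharacter_freeAbelianTopology_iff]
  intro h
  have h0 : signChar x₀ U (FreeAbelianGroup.of x₀) = 1 := by
    rw [signChar_apply, coeffSum_of_mem (mem_of_mem_nhds (hU.mem 0)),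
      coeffSum_of_mem (Set.mem_singleton x₀), sub_self, zpow_zero]
  have hne : (1 : Circle) ≠ -1 := fun h => by
    have := congrArg (fun u : Circle => (u : ℂ).re) h
    norm_num at this
  have h1 := h.tendsto x₀
  rw [h0] at h1
  have h2 : ∀ᶠ x in 𝓝[≠] x₀, signChar x₀ U (FreeAbelianGroup.of x) ≠ -1 :=
    (h1.eventually_ne hne).filter_mono nhdsWithin_le_nhds
  have h3 : ∀ᶠ x in 𝓝[≠] x₀, x ∈ U 0 := mem_nhdsWithin_of_mem_nhds (hU.mem 0)
  have h4 : ∀ᶠ x in 𝓝[≠] x₀, x ∈ ({x₀}ᶜ : Set X) := self_mem_nhdsWithin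
  obtain ⟨x, hx, hxU, hx0⟩ := (h2.and (h3.and h4)).exists
  apply hx
  rw [signChar_apply, coeffSum_of_mem hxU, coeffSum_of_notMem hx0, sub_zero, zpow_one]

variable [T1Space X]

theorem eventually_notMem_of_ne (hU : (𝓝 x₀).HasAntitoneBasis U) {x : X} (hx : x ≠ x₀) :
    ∀ᶠ n in atTop, x ∉ U n := by
  obtain ⟨n, hn⟩ := hU.mem_iff.1 (isOpen_ne.mem_nhds hx.symm)
  filter_upwards [eventually_ge_atTop n] with k hk h
  exact hn (hU.antitone hk h) rfl

/-- Only finitely many points occur in `g`, and each one other than `x₀` eventually leaves `U n`. -/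
theorem eventually_coeffSum_eq (hU : (𝓝 x₀).HasAntitoneBasis U) (g : FreeAbelianGroup X) :
    ∀ᶠ n in atTop, coeffSum (U n) g = coeffSum {x₀} g := by
  induction g using FreeAbelianGroup.induction_on with
  | zero => simp
  | of x =>
    by_cases hx : x = x₀
    · subst hx
      refine Eventually.of_forall fun n => ?_
      rw [coeffSum_of_mem (mem_of_mem_nhds (hU.mem n)), coeffSum_of_mem (Set.mem_singleton x)]
    · filter_upwards [eventually_notMem_of_ne hU hx] with n hn
      rw [coeffSum_of_notMem hn, coeffSum_of_notMem (Set.mem_singleton_iff.not.2 hx)]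
  | neg x h => simpa using h
  | add a b ha hb =>
    filter_upwards [ha, hb] with n h1 h2
    simp only [map_add, h1, h2]

theorem eventually_layerSum_eq_zero (hU : (𝓝 x₀).HasAntitoneBasis U) (g : FreeAbelianGroup X) :
    ∃ n₀, ∀ n ≥ n₀, layerSum U n g = 0 := by
  obtain ⟨n₀, h⟩ := eventually_atTop.1 (eventually_coeffSum_eq hU g)
  refine ⟨n₀, fun n hn => ?_⟩
  rw [layerSum_apply, h n hn, h (n + 1) (by omega), sub_self]

/-- The layer sums telescope to the coefficient sum over `U 0` without `x₀`. -/
theorem even_coeffSum_sub (hU : (𝓝 x₀).HasAntitoneBasis U) {g : FreeAbelianGroup X}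
    (h : ∀ n, Even (layerSum U n g)) : Even (coeffSum (U 0) g - coeffSum {x₀} g) := by
  obtain ⟨N, hN⟩ := (eventually_coeffSum_eq hU g).exists
  rw [← hN, ← Finset.sum_range_sub' fun n => coeffSum (U n) g]
  exact Finset.even_sum _ fun n _ => h n

/-- A group topology finer than `layerTopology U z` and `layerTopology U (-z)` has a character
that is not continuous on the free abelian topological group. -/
theorem isCharacter_signChar_of_le (hU : (𝓝 x₀).HasAntitoneBasis U) {z : Circle}
    {μ : AddGroupTopology (FreeAbelianGroup X)} (h1 : μ ≤ layerTopology U z)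
    (h2 : μ ≤ layerTopology U (-z)) : IsCharacter μ (signChar x₀ U) := by
  have hne : (1 : Circle) ≠ -1 := fun h => by
    have := congrArg (fun u : Circle => (u : ℂ).re) h
    norm_num at this
  -- Quotients of elements of `V` avoid `-1`, the value of `(-z) ^ k / z ^ k` for odd `k`.
  obtain ⟨V, hV, hVV⟩ := exists_nhds_split_inv (isOpen_ne.mem_nhds hne)
  have h1' := addGroupTopology_le_iff.1 (h1.trans inf_le_right)
    ((hasBasis_nhds_zero_uniformTopology _).mem_of_mem hV)
  have h2' := addGroupTopology_le_iff.1 (h2.trans inf_le_right)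
    ((hasBasis_nhds_zero_uniformTopology _).mem_of_mem hV)
  rw [isCharacter_iff]
  intro W hW
  filter_upwards [h1', h2'] with g hg hg'
  have he : Even (coeffSum (U 0) g - coeffSum {x₀} g) := by
    refine even_coeffSum_sub hU fun n => ?_
    by_contra ho
    rw [Int.not_even_iff_odd] at ho
    have h3 := hVV _ (hg' n) _ (hg n)
    rw [layerChar_apply, layerChar_apply, ho.neg_zpow, neg_div, div_self'] at h3
    exact h3 rfl
  rw [signChar_apply, he.neg_one_zpow]
  exact mem_of_mem_nhds hW

/-- Near `x` membership in every `U n` is constant: finitely many clopen conditions up to an `n₀`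
with `x ∉ U n₀` decide the rest by monotonicity. So all layer characters are trivial on `y - x`. -/
theorem tendsto_layerTopology_of_ne (hU : (𝓝 x₀).HasAntitoneBasis U) (hc : ∀ n, IsClopen (U n))
    (z : Circle) {x : X} (hx : x ≠ x₀) :
    Tendsto (fun y => FreeAbelianGroup.of y - FreeAbelianGroup.of x) (𝓝 x)
      (@nhds _ (layerTopology U z).toTopologicalSpace 0) := by
  rw [nhds_zero_layerTopology, tendsto_inf]
  refine ⟨tendsto_of_sub_of x, (hasBasis_nhds_zero_uniformTopology _).tendsto_right_iff.2
    fun V hV => ?_⟩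
  obtain ⟨n₀, hn₀⟩ := (eventually_notMem_of_ne hU hx).exists
  have h1 : ∀ᶠ y in 𝓝 x, ∀ n ∈ Finset.range (n₀ + 1), (y ∈ U n ↔ x ∈ U n) := by
    refine (Filter.eventually_all_finset _).2 fun n _ => ?_
    by_cases h : x ∈ U n
    · filter_upwards [(hc n).isOpen.mem_nhds h] with y hy using iff_of_true hy h
    · filter_upwards [(hc n).compl.isOpen.mem_nhds h] with y hy using iff_of_false hy h
  filter_upwards [h1] with y hy
  have h2 (n : ℕ) : y ∈ U n ↔ x ∈ U n := by
    rcases le_total n n₀ with h | h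
    · exact hy n (by simpa [Nat.lt_succ_iff] using h)
    · have h3 : y ∉ U n₀ := fun h4 => hn₀ ((hy n₀ (by simp)).1 h4)
      exact iff_of_false (fun h4 => h3 (hU.antitone h h4)) fun h4 => hn₀ (hU.antitone h h4)
  have h3 (n : ℕ) : coeffSum (U n) (FreeAbelianGroup.of y) =
      coeffSum (U n) (FreeAbelianGroup.of x) := by
    by_cases h : x ∈ U n
    · rw [coeffSum_of_mem h, coeffSum_of_mem ((h2 n).2 h)]
    · rw [coeffSum_of_notMem h, coeffSum_of_notMem fun h4 => h ((h2 n).1 h4)]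
  intro n
  rw [layerChar_apply, map_sub, layerSum_apply, layerSum_apply, h3, h3, sub_self, zpow_zero]
  exact mem_of_mem_nhds hV

/-- Multiples of small elements in successive layers can be added up. -/
theorem exists_mem_layerSum_eq (hU : (𝓝 x₀).HasAntitoneBasis U)
    (χ : AddChar (FreeAbelianGroup X) Circle) {F : Filter X} [F.NeBot] (hF : F ≤ 𝓝 x₀)
    {w : Circle}
    (hw : Tendsto (fun y => χ (FreeAbelianGroup.of y - FreeAbelianGroup.of x₀)) F (𝓝 w))
    (m : ℤ) (k : ℕ) :
    ∀ W ∈ @nhds _ (freeAbelianTopology X).toTopologicalSpace 0, ∀ O ∈ 𝓝 ((w ^ m) ^ k),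
      ∃ g ∈ W, χ g ∈ O ∧ ∀ n, layerSum U n g = 0 ∨ layerSum U n g = m := by
  let _ := (freeAbelianTopology X).toTopologicalSpace
  have := (freeAbelianTopology X).toIsTopologicalAddGroup
  induction k with
  | zero =>
    intro W hW O hO
    refine ⟨0, mem_of_mem_nhds hW, ?_, fun n => Or.inl (map_zero _)⟩
    rw [AddChar.map_zero_eq_one]
    simpa using mem_of_mem_nhds hO
  | succ k ih =>
    intro W hW O hO
    obtain ⟨W', hW', hWW⟩ := exists_nhds_zero_half hW
    rw [pow_succ] at hO
    obtain ⟨O₁, hO₁, O₂, hO₂, hOO⟩ := mem_prod_iff.1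
      (nhds_prod_eq (x := (w ^ m) ^ k) (y := w ^ m) ▸ continuous_mul.continuousAt hO)
    obtain ⟨g, hgW, hgO, hg⟩ := ih W' hW' O₁ hO₁
    -- Choosing the next `y` in `U n₀` puts it beyond all layers where `g` has a nonzero sum, so the
    -- contributions never overlap.
    obtain ⟨n₀, hn₀⟩ := eventually_layerSum_eq_zero hU g
    have e1 : ∀ᶠ y in F, m • (FreeAbelianGroup.of y - FreeAbelianGroup.of x₀) ∈ W' := by
      have h1 := ((tendsto_of_sub_of x₀).mono_left hF).const_smul m
      rw [smul_zero] at h1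
      exact h1 hW'
    have e2 : ∀ᶠ y in F, χ (m • (FreeAbelianGroup.of y - FreeAbelianGroup.of x₀)) ∈ O₂ := by
      have h1 := hw.zpow m
      simp only [← AddChar.map_zsmul_eq_zpow] at h1
      exact h1 hO₂
    obtain ⟨y, hy1, hy2, hyU⟩ := (e1.and (e2.and (hF (hU.mem n₀)))).exists
    refine ⟨g + m • (FreeAbelianGroup.of y - FreeAbelianGroup.of x₀), hWW _ hgW _ hy1, ?_,
      fun n => ?_⟩
    · rw [AddChar.map_add_eq_mul]
      exact hOO (Set.mk_mem_prod hgO hy2)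
    · have hx (j : ℕ) : coeffSum (U j) (FreeAbelianGroup.of x₀) = 1 :=
        coeffSum_of_mem (mem_of_mem_nhds (hU.mem j))
      have h1 : layerSum U n (g + m • (FreeAbelianGroup.of y - FreeAbelianGroup.of x₀)) =
          layerSum U n g + m * (coeffSum (U n) (FreeAbelianGroup.of y) -
            coeffSum (U (n + 1)) (FreeAbelianGroup.of y)) := by
        rw [map_add, map_zsmul, map_sub, layerSum_apply U n (FreeAbelianGroup.of y),
          layerSum_apply U n (FreeAbelianGroup.of x₀), hx, hx, sub_self, sub_zero, smul_eq_mul]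
      rw [h1]
      rcases lt_or_ge n n₀ with h | h
      · rw [coeffSum_of_mem (hU.antitone h.le hyU), coeffSum_of_mem (hU.antitone h hyU)]
        simpa using hg n
      · rw [hn₀ n h]
        by_cases h2 : y ∈ U (n + 1)
        · rw [coeffSum_of_mem h2, coeffSum_of_mem (hU.antitone n.le_succ h2)]
          simp
        · rw [coeffSum_of_notMem h2]
          by_cases h3 : y ∈ U n
          · rw [coeffSum_of_mem h3]
            simp
          · rw [coeffSum_of_notMem h3]
            simp

/-- The layer topology of an element of infinite order has no new characters. -/
theorem areCompatible_layerTopology (hU : (𝓝 x₀).HasAntitoneBasis U) (hc : ∀ n, IsClopen (U n))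
    {z : Circle} (hz : ¬ IsOfFinOrder z) :
    AreCompatible (layerTopology U z) (freeAbelianTopology X) := by
  intro χ
  refine ⟨fun hχ => ?_, fun hχ => hχ.mono (layerTopology_le U z)⟩
  have hχ' := isCharacter_iff.1 hχ
  rw [isCharacter_freeAbelianTopology_iff, continuous_iff_continuousAt]
  intro x
  suffices Tendsto (fun y => χ (FreeAbelianGroup.of y - FreeAbelianGroup.of x)) (𝓝 x) (𝓝 1) by
    have h := this.mul_const (χ (FreeAbelianGroup.of x))
    simpa only [← AddChar.map_add_eq_mul, sub_add_cancel, one_mul, ContinuousAt] using h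
  by_cases hx : x = x₀
  swap
  · exact fun V hV => tendsto_layerTopology_of_ne hU hc z hx (hχ' V hV)
  subst hx
  -- Along an ultrafilter the values converge by compactness of the circle, so only the limit `w`
  -- must be identified.
  rw [tendsto_iff_ultrafilter]
  intro F hF
  set w := (F.map fun y => χ (FreeAbelianGroup.of y - FreeAbelianGroup.of x)).lim
  have hw : Tendsto (fun y => χ (FreeAbelianGroup.of y - FreeAbelianGroup.of x)) F (𝓝 w) :=
    Ultrafilter.le_nhds_lim _
  by_cases hw1 : w = 1
  · rwa [hw1] at hw
  exfalso
  have hP := hχ' _ Circle.setOf_re_pos_mem_nhds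
  rw [nhds_zero_layerTopology] at hP
  obtain ⟨W, hW, W', hW', hWW⟩ := mem_inf_iff_superset.1 hP
  obtain ⟨V, hV, hVW⟩ := (hasBasis_nhds_zero_uniformTopology _).mem_iff.1 hW'
  -- Layer sums 0 and `m` both keep the layer characters in `V`, while `k` summands push `χ` towards
  -- `(w ^ m) ^ k`, in the open left half circle.
  obtain ⟨m, hm, hwm⟩ := Circle.exists_zpow_mem_zpow_ne_one hz hw1 hV
  obtain ⟨k, hk⟩ := Circle.exists_re_pow_neg hwm
  have hO : {u : Circle | (u : ℂ).re < 0} ∈ 𝓝 ((w ^ m) ^ k) :=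
    (isOpen_lt (Complex.continuous_re.comp continuous_subtype_val) continuous_const).mem_nhds hk
  obtain ⟨g, hgW, hgO, hg⟩ := exists_mem_layerSum_eq hU χ hF hw m k W hW _ hO
  refine lt_asymm (a := ((χ g : Circle) : ℂ).re) hgO (hWW ⟨hgW, hVW fun n => ?_⟩)
  rw [layerChar_apply]
  rcases hg n with h | h <;> rw [h]
  · rw [zpow_zero]
    exact mem_of_mem_nhds hV
  · exact hm

end Layers

/-! ### Countable spaces and the conclusion -/

/-- Only countably many radii are distances to `x`; for any other radius the open and closed balls
coincide. -/
theorem IsZeroDimensional.of_countable {X : Type*} [TopologicalSpace X] [MetrizableSpace X]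
    [Countable X] [Nonempty X] : IsZeroDimensional X where
  nonempty := inferInstance
  t1 := inferInstance
  clopen_base := by
    let _ := metrizableSpaceMetric X
    refine isTopologicalBasis_of_isOpen_of_nhds (fun s hs => hs.isOpen) fun x O hx hO => ?_
    obtain ⟨ε, hε, hεO⟩ := Metric.isOpen_iff.1 hO x hx
    obtain ⟨r, hr, hr'⟩ : (Set.Ioo 0 ε \ Set.range fun y => dist y x).Nonempty := by
      refine Set.nonempty_of_not_subset fun h => ?_
      exact Cardinal.Real.Ioo_countable_iff.not.2 (not_le.2 hε)
        ((Set.countable_range _).mono h)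
    refine ⟨Metric.ball x r, ⟨?_, Metric.isOpen_ball⟩, Metric.mem_ball_self hr.1,
      (Metric.ball_subset_ball hr.2.le).trans hεO⟩
    have : Metric.ball x r = Metric.closedBall x r := by
      ext y
      rw [Metric.mem_ball, Metric.mem_closedBall]
      exact ⟨le_of_lt, fun h => lt_of_le_of_ne h fun h' => hr' ⟨y, h'⟩⟩
    rw [this]
    exact Metric.isClosed_closedBall

theorem exists_nhdsNE_neBot {X : Type*} [TopologicalSpace X] (hX : ¬ DiscreteTopology X) :
    ∃ x : X, (𝓝[≠] x).NeBot := by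
  by_contra! h
  exact hX (discreteTopology_iff_nhds_ne.2 h)

theorem IsZeroDimensional.exists_clopen_antitone_basis {X : Type*} [TopologicalSpace X]
    [FirstCountableTopology X] (h : IsZeroDimensional X) (x : X) :
    ∃ U : ℕ → Set X, (𝓝 x).HasAntitoneBasis U ∧ ∀ n, IsClopen (U n) := by
  obtain ⟨U, hU, hb⟩ := h.clopen_base.nhds_hasBasis (a := x) |>.exists_antitone_subbasis
  exact ⟨U, hb, fun n => (hU n).1⟩

theorem theoremt {X : Type*} [TopologicalSpace X] [MetrizableSpace X]
    (hX : ¬ DiscreteTopology X) :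
    (IsZeroDimensional X →
      IsLocallyQuasiConvex (freeAbelianTopology X) ∧
        ¬ IsPreMackeyGroup (freeAbelianTopology X) ∧
        ¬ IsQuasiMackeyGroup (freeAbelianTopology X)) ∧
    (Countable X → ¬ IsPreMackeyGroup (freeAbelianTopology X)) := by
  obtain ⟨x₀, hx₀⟩ := exists_nhdsNE_neBot hX
  have key : IsZeroDimensional X →
      IsLocallyQuasiConvex (freeAbelianTopology X) ∧
        ¬ IsPreMackeyGroup (freeAbelianTopology X) ∧
        ¬ IsQuasiMackeyGroup (freeAbelianTopology X) := by
    intro h0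
    obtain ⟨U, hU, hc⟩ := h0.exists_clopen_antitone_basis x₀
    obtain ⟨z, hz⟩ := Circle.exists_not_isOfFinOrder
    have hcompat {u : Circle} (hu : ¬ IsOfFinOrder u) := areCompatible_layerTopology hU hc hu
    refine ⟨isLocallyQuasiConvex_freeAbelianTopology, ?_, ?_⟩
    · rintro ⟨μ, ⟨-, hμ⟩, hμτ⟩
      have hle {u : Circle} (hu : ¬ IsOfFinOrder u) : μ ≤ layerTopology U u :=
        hμ _ (isLocallyQuasiConvex_layerTopology U u) fun χ => (hμτ χ).trans (hcompat hu χ).symm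
      exact not_isCharacter_signChar hU ((hμτ _).1 (isCharacter_signChar_of_le hU (hle hz)
        (hle (Circle.not_isOfFinOrder_neg hz))))
    · rintro ⟨-, -, hτ⟩
      -- A compatible locally quasi-convex refinement that is not strict must coincide with the
      -- topology of A(X), so A(X) itself can serve as the common refinement.
      have hle {u : Circle} (hu : ¬ IsOfFinOrder u) :
          freeAbelianTopology X ≤ layerTopology U u := by
        by_contra hlt
        exact hτ ⟨_, isLocallyQuasiConvex_layerTopology U u, hcompat hu,
          lt_of_le_not_ge (layerTopology_le U u) hlt⟩
      exact not_isCharacter_signChar hU (isCharacter_signChar_of_le hU (hle hz)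
        (hle (Circle.not_isOfFinOrder_neg hz)))
  refine ⟨key, fun hcount => ?_⟩
  have : Nonempty X := ⟨x₀⟩
  exact (key .of_countable).2.1
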